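/- Let $n\in\mathbb N$ and $[n]=\{1,\dots,n\}$. A price schedule is a family of real numbers $p=\{p_I\}_{I\subseteq[n]}$ with $p_\emptyset=0$. Its regions are $$D_I=\Bigl\{x\in[0,1]^n : \sum_{i\in I}x_i-p_I\ \ge\ \sum_{j\in J}x_j-p_J\ \text{ for all } J\subseteq[n]\Bigr\}\qquad(I\subseteq[n]),$$ and its expected revenue (for a valuation uniformly distributed in $[0,1]^n$) is $\operatorname{Rev}(p)=\sum_{I\subseteq[n]}p_I\operatorname{vol}_n D_I$. Let $\pi_I$ denote the projection onto the coordinates in $I$, write $\bar D_I=\pi_I(D_I)$ and $\bar D_I^i=\pi_{I\setminus\{i\}}(\bar D_I)$ for $i\in I$, and define the deficiency $$\delta_n(I)=\operatorname{vol}_{|I|}\bar D_I-\frac1{n+1}\sum_{i\in I}\operatorname{vol}_{|I|-1}\bar D_I^i ,$$ where $\operatorname{vol}_0$ of a point is $1$ and $\operatorname{vol}_0$ of the empty set is $0$. The price schedule is submodular if $p_{A\cup B}+p_{A\cap B}\le p_A+p_B$ for all $A,B\subseteq[n]$. If equality holds for two bundles $A,B\subseteq[n]$ with $A\not\subseteq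 B$ and $B\not\subseteq A$, then $A\cup B$ and $A\cap B$ are called left tight, and $A$ and $B$ are called right tight. A bundle is tight if it is left tight or right tight; it is just left tight (just right tight) if it is left tight but not right tight (right tight but not left tight). **Proposition.** Let $p$ be a submodular price schedule which maximizes the expected revenue among all submodular price schedules. Then, for all $I\subseteq[n]$: 1. if $I\neq\emptyset$ is not tight and $\operatorname{vol}_n D_I>0$, then $\delta_n(I)=0$; 2. if $I$ is not tight and $\operatorname{vol}_n D_I=0$, then $\delta_n(I)\ge0$; 3. if $I$ is just left tight, then $\delta_n(I)\ge0$; 4. if $I$ is just right tight and $\operatorname{vol}_n D_I>0$, then $\delta_n(I)\le0$. -/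

import Mathlib

namespace DetAuction

/-- A price schedule for `n` items: a real price for each bundle, where the empty bundle is free. -/
@[ext]
structure PriceSchedule (n : ℕ) where
  /-- the price of a bundle -/
  price : Finset (Fin n) → ℝ
  price_empty : price ∅ = 0

namespace PriceSchedule

variable {n : ℕ}

/-- The region `D_I`: the valuations in the unit cube at which the buyer's utility
`∑ j ∈ J, x j - p_J` is maximized, among all bundles `J`, by the bundle `I`. -/
def region (p : PriceSchedule n) (I : Finset (Fin n)) : Set (Fin n → ℝ) :=
  {x | (∀ i, x i ∈ Set.Icc (0 : ℝ) 1) ∧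
    ∀ J : Finset (Fin n), ∑ j ∈ J, x j - p.price J ≤ ∑ i ∈ I, x i - p.price I}

/-- The `n`-dimensional volume of `D_I`. -/
noncomputable def regionVol (p : PriceSchedule n) (I : Finset (Fin n)) : ℝ :=
  MeasureTheory.volume.real (p.region I)

/-- The projection of `D_I` onto the coordinates in `I`. -/
def projRegion (p : PriceSchedule n) (I : Finset (Fin n)) : Set (I → ℝ) :=
  I.restrict '' p.region I

/-- The projection of `D_I` onto the coordinates in `I`, followed by the projection onto the
coordinates in `I \ {i}`. -/
def projRegionErase (p : PriceSchedule n) (I : Finset (Fin n)) (i : Fin n) :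
    Set (I.erase i → ℝ) :=
  Finset.restrict₂ (π := fun _ => ℝ) (Finset.erase_subset i I) '' p.projRegion I

/-- The deficiency `δ_n(I)`. Volumes are Lebesgue measures on `ℝ^I` and `ℝ^(I \ {i})`; in
dimension zero this is the counting measure of the one-point space. -/
noncomputable def deficiency (p : PriceSchedule n) (I : Finset (Fin n)) : ℝ :=
  MeasureTheory.volume.real (p.projRegion I) -
    1 / ((n : ℝ) + 1) * ∑ i ∈ I, MeasureTheory.volume.real (p.projRegionErase I i)

/-- The expected revenue, for valuations that are uniformly distributed in the unit cube. -/
noncomputable def revenue (p : PriceSchedule n) : ℝ :=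
  ∑ I : Finset (Fin n), p.price I * p.regionVol I

def IsSubmodular (p : PriceSchedule n) : Prop :=
  ∀ I J : Finset (Fin n), p.price (I ∪ J) + p.price (I ∩ J) ≤ p.price I + p.price J

/-- The submodularity inequality of the pair `A`, `B` holds with equality. The bundles are required
to be incomparable, since otherwise the two sides are the same expression. -/
def TightPair (p : PriceSchedule n) (A B : Finset (Fin n)) : Prop :=
  ¬ A ⊆ B ∧ ¬ B ⊆ A ∧ p.price (A ∪ B) + p.price (A ∩ B) = p.price A + p.price B

def LeftTight (p : PriceSchedule n) (I : Finset (Fin n)) : Prop :=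
  ∃ A B : Finset (Fin n), p.TightPair A B ∧ (I = A ∪ B ∨ I = A ∩ B)

def RightTight (p : PriceSchedule n) (I : Finset (Fin n)) : Prop :=
  ∃ A B : Finset (Fin n), p.TightPair A B ∧ (I = A ∨ I = B)

def Tight (p : PriceSchedule n) (I : Finset (Fin n)) : Prop :=
  p.LeftTight I ∨ p.RightTight I

end PriceSchedule

end DetAuction

open MeasureTheory Set Filter Topology

namespace DetAuction

/-! Let u be the buyer's indirect utility. Off a null set of ties, the buyer pays value minus
utility, and the i-th partial derivative of u indicates whether item i is bought. Integration by
parts in each coordinate therefore turns the revenue into ∑ᵢ ∫ u(x with xᵢ = 1) - (n+1) ∫ u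
(`revenue_eq`), which is linear in u. Optimality is tested by perturbing prices and comparing the
change of u on the faces xᵢ = 1 with its change inside.

Submodularity makes bundle utilities supermodular, so I is optimal iff it beats its subsets, a
condition on the coordinates in I, and its supersets, a condition on the others. Hence D_I is,
within the cube, a product whose first factor has the volumes appearing in the deficiency.

If I is not right tight, its price may be lowered by a small s. The gain in u lies between two
products with the same factor outside I (`sum_measure_update_le_of_shift_neg`). That factor cancels,
and s → 0 gives δ(I) ≥ 0, even when D_I is null.

If I is not left tight, its price may be raised, which bounds (n+1) vol D_I by the face measures
over all i (`mul_regionVol_le`). Faces with i ∉ I contribute nothing, since otherwise offering i as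
an add-on just below price 1 would raise revenue (`measure_update_util_eq_eq_zero`). Cancelling the
outer factor, positive when D_I has positive volume, gives δ(I) ≤ 0. -/

/-! ### The uniform measure on the cube and splitting of coordinates -/

/-- The uniform distribution on the unit cube `[0,1]^ι`. -/
noncomputable def cubeMeasure (ι : Type*) [Fintype ι] : Measure (ι → ℝ) :=
  Measure.pi fun _ => volume.restrict (Icc (0 : ℝ) 1)

instance isProbabilityMeasure_restrict_Icc :
    IsProbabilityMeasure (volume.restrict (Icc (0 : ℝ) 1)) := ⟨by simp⟩

instance isProbabilityMeasure_cubeMeasure (ι : Type*) [Fintype ι] :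
    IsProbabilityMeasure (cubeMeasure ι) := by
  unfold cubeMeasure; infer_instance

theorem cubeMeasure_eq (ι : Type*) [Fintype ι] :
    cubeMeasure ι = volume.restrict (univ.pi fun _ => Icc (0 : ℝ) 1) := by
  unfold cubeMeasure
  rw [← Measure.restrict_pi_pi]
  rfl

theorem ae_mem_cube (ι : Type*) [Fintype ι] :
    ∀ᵐ x ∂cubeMeasure ι, ∀ i, x i ∈ Icc (0 : ℝ) 1 := by
  rw [cubeMeasure_eq]
  filter_upwards [ae_restrict_mem (MeasurableSet.univ_pi fun _ => measurableSet_Icc)] with x hx i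
  exact hx i (mem_univ i)

theorem volume_real_eq_cubeMeasure {ι : Type*} [Fintype ι] {s : Set (ι → ℝ)}
    (hs : ∀ x ∈ s, ∀ i, x i ∈ Icc (0 : ℝ) 1) :
    volume.real s = (cubeMeasure ι).real s := by
  rw [cubeMeasure_eq, measureReal_def, measureReal_def, Measure.restrict_eq_self]
  exact fun x hx i _ => hs x hx i

/-- The coordinates are independent, so gluing two independent uniform points along I gives a
uniform point. It suffices to check boxes. -/
theorem measurePreserving_piecewise {ι : Type*} [Fintype ι] [DecidableEq ι] (I : Finset ι) :
    MeasurePreserving (fun z : (ι → ℝ) × (ι → ℝ) => I.piecewise z.1 z.2)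
      ((cubeMeasure ι).prod (cubeMeasure ι)) (cubeMeasure ι) := by
  have hm : Measurable fun z : (ι → ℝ) × (ι → ℝ) => I.piecewise z.1 z.2 := by
    refine measurable_pi_lambda _ fun i => ?_
    by_cases h : i ∈ I <;> simp only [Finset.piecewise, h, if_true, if_false] <;> fun_prop
  refine ⟨hm, ?_⟩
  symm
  unfold cubeMeasure
  refine Measure.pi_eq fun s hs => ?_
  rw [Measure.map_apply hm (MeasurableSet.univ_pi hs)]
  have : (fun z : (ι → ℝ) × (ι → ℝ) => I.piecewise z.1 z.2) ⁻¹' univ.pi s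
      = (univ.pi fun i => if i ∈ I then s i else univ) ×ˢ
        (univ.pi fun i => if i ∈ I then univ else s i) := by
    ext z
    simp only [mem_preimage, Set.mem_pi, mem_univ, true_imp_iff, mem_prod, ← forall_and]
    refine forall_congr' fun i => ?_
    by_cases h : i ∈ I <;> simp [h]
  rw [this, Measure.prod_prod, Measure.pi_pi, Measure.pi_pi, ← Finset.prod_mul_distrib]
  refine Finset.prod_congr rfl fun i _ => ?_
  by_cases h : i ∈ I <;> simp [h]

theorem integral_piecewise {ι : Type*} [Fintype ι] [DecidableEq ι] (I : Finset ι)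
    {f : (ι → ℝ) → ℝ} (hf : Integrable f (cubeMeasure ι)) :
    ∫ x, f x ∂cubeMeasure ι =
      ∫ x, ∫ y, f (I.piecewise y x) ∂cubeMeasure ι ∂cubeMeasure ι := by
  have hp := measurePreserving_piecewise I
  have hp' := hp.comp (Measure.measurePreserving_swap (μ := cubeMeasure ι) (ν := cubeMeasure ι))
  have hi := hp'.integrable_comp_of_integrable hf
  rw [← hp'.map_eq, integral_map hp'.measurable.aemeasurable (by rw [hp'.map_eq]; exact hf.1)]
  rw [hp'.map_eq]
  exact integral_prod _ hi

/-- Functions of disjoint sets of coordinates are uncorrelated. -/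
theorem integral_mul_of_piecewise {ι : Type*} [Fintype ι] [DecidableEq ι] (I : Finset ι)
    {f g : (ι → ℝ) → ℝ} (hfg : Integrable (fun x => f x * g x) (cubeMeasure ι))
    (hf : ∀ x y, f (I.piecewise y x) = f y) (hg : ∀ x y, g (I.piecewise y x) = g x) :
    ∫ x, f x * g x ∂cubeMeasure ι = (∫ x, f x ∂cubeMeasure ι) * ∫ x, g x ∂cubeMeasure ι := by
  rw [integral_piecewise I hfg]
  simp only [hf, hg]
  simp only [integral_mul_const, integral_const_mul]

/-- Integration over one coordinate at a time. -/
theorem integral_update {ι : Type*} [Fintype ι] [DecidableEq ι] (i : ι)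
    {f : (ι → ℝ) → ℝ} (hm : Measurable f) (hf : Integrable f (cubeMeasure ι)) :
    ∫ x, f x ∂cubeMeasure ι =
      ∫ x, (∫ t in Icc (0 : ℝ) 1, f (Function.update x i t)) ∂cubeMeasure ι := by
  rw [integral_piecewise {i} hf]
  refine integral_congr_ae (Eventually.of_forall fun x => ?_)
  have h := measurePreserving_eval (fun _ : ι => volume.restrict (Icc (0 : ℝ) 1)) i
  simp only [Finset.piecewise_singleton]
  have hm' : Measurable fun t => f (Function.update x i t) := by fun_prop
  rw [← h.map_eq, integral_map h.measurable.aemeasurable hm'.aestronglyMeasurable]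
  rfl

/-- A set that meets every line parallel to a coordinate axis in at most a point is null. -/
theorem cubeMeasure_eq_zero_of_update {ι : Type*} [Fintype ι] [DecidableEq ι] (i : ι)
    {s : Set (ι → ℝ)} (hs : MeasurableSet s)
    (h : ∀ x, ∃ c : ℝ, ∀ t, Function.update x i t ∈ s → t = c) : cubeMeasure ι s = 0 := by
  rw [← measureReal_eq_zero_iff, ← integral_indicator_one hs,
    integral_update i (measurable_one.indicator hs)
      ((integrable_const 1).indicator hs)]
  refine integral_eq_zero_of_ae (Eventually.of_forall fun x => ?_)
  obtain ⟨c, hc⟩ := h x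
  refine integral_eq_zero_of_ae ?_
  have : ∀ᵐ t ∂(volume.restrict (Icc (0 : ℝ) 1)), t ≠ c :=
    ae_restrict_of_ae (Measure.ae_ne volume c)
  filter_upwards [this] with t ht
  exact indicator_of_notMem (fun hh => ht (hc t hh)) _

theorem measurePreserving_restrict_cubeMeasure {ι : Type*} [Fintype ι] (I : Finset ι) :
    MeasurePreserving (I.restrict (π := fun _ => ℝ)) (cubeMeasure ι) (cubeMeasure I) := by
  refine ⟨by fun_prop, ?_⟩
  have h := Measure.infinitePi_map_restrict (fun _ : ι => volume.restrict (Icc (0 : ℝ) 1)) (I := I)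
  rw [Measure.infinitePi_eq_pi] at h
  exact h

/-- Integration by parts for a convex function with slopes `0` and `1`. -/
theorem integral_Icc_mul_ite_add_integral_max (a b : ℝ) :
    (∫ t in Icc (0 : ℝ) 1, t * (if a < b + t then 1 else 0)) + (∫ t in Icc (0 : ℝ) 1, max a (b + t))
      = max a (b + 1) := by
  have hI1 : IntegrableOn (fun t : ℝ => t * (if a < b + t then (1:ℝ) else 0)) (Icc 0 1) := by
    have : Integrable (fun t : ℝ => if a < b + t then (1:ℝ) else 0)
        (volume.restrict (Icc (0 : ℝ) 1)) := by
      have hs : MeasurableSet {t : ℝ | a < b + t} := measurableSet_lt (by fun_prop) (by fun_prop)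
      refine ((integrable_const (1:ℝ)).indicator hs).congr (Eventually.of_forall fun t => ?_)
      simp [indicator]
    exact IntegrableOn.continuousOn_mul continuousOn_id this isCompact_Icc
  have hI2 : IntegrableOn (fun t : ℝ => max a (b + t)) (Icc 0 1) :=
    (by fun_prop : Continuous fun t : ℝ => max a (b + t)).continuousOn.integrableOn_Icc
  rw [← integral_add hI1 hI2, integral_Icc_eq_integral_Ioc,
    ← intervalIntegral.integral_of_le zero_le_one]
  -- The integrand is the derivative of t * max a (b + t) away from the kink t = a - b.
  rw [integral_eq_of_hasDerivAt_off_countable_of_le (fun t : ℝ => t * max a (b + t)) _ zero_le_one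
    (countable_singleton (a - b)) (by fun_prop)]
  · simp
  · rintro x ⟨-, hx⟩
    have hx : x ≠ a - b := by simpa using hx
    rcases lt_or_gt_of_ne hx with h | h
    · have hd : HasDerivAt (fun t : ℝ => t * a) (1 * a) x := (hasDerivAt_id x).mul_const a
      have he : (fun t : ℝ => t * max a (b + t)) =ᶠ[𝓝 x] fun t => t * a := by
        filter_upwards [eventually_lt_nhds h] with t ht
        rw [max_eq_left (by linarith)]
      convert hd.congr_of_eventuallyEq he using 1
      rw [if_neg (by linarith), max_eq_left (by linarith)]; ring
    · have hd : HasDerivAt (fun t : ℝ => t * (b + t)) (1 * (b + x) + x * 1) x :=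
        (hasDerivAt_id x).mul ((hasDerivAt_id x).const_add b)
      have he : (fun t : ℝ => t * max a (b + t)) =ᶠ[𝓝 x] fun t => t * (b + t) := by
        filter_upwards [eventually_gt_nhds h] with t ht
        rw [max_eq_right (by linarith)]
      convert hd.congr_of_eventuallyEq he using 1
      rw [if_pos (by linarith), max_eq_right (by linarith)]; ring
  · rw [intervalIntegrable_iff_integrableOn_Icc_of_le zero_le_one]
    exact hI1.add hI2

theorem integrable_cubeMeasure_of_continuous {ι : Type*} [Fintype ι] {f : (ι → ℝ) → ℝ}
    (hf : Continuous f) : Integrable f (cubeMeasure ι) := by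
  rw [cubeMeasure_eq]
  exact hf.continuousOn.integrableOn_compact (isCompact_univ_pi fun _ => isCompact_Icc)

/-! ### Indirect utility and its dependence on one coordinate -/

namespace PriceSchedule

variable {n : ℕ}

/-- The utility of the bundle `J` for a buyer with valuation `x`. -/
def bundleUtil (p : PriceSchedule n) (J : Finset (Fin n)) (x : Fin n → ℝ) : ℝ :=
  ∑ j ∈ J, x j - p.price J

/-- The indirect utility of a buyer with valuation `x`. -/
noncomputable def util (p : PriceSchedule n) (x : Fin n → ℝ) : ℝ :=
  Finset.univ.sup' ⟨∅, Finset.mem_univ _⟩ fun J => p.bundleUtil J x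

/-- The greatest utility of a bundle without `i`. -/
noncomputable def utilWithout (p : PriceSchedule n) (i : Fin n) (x : Fin n → ℝ) : ℝ :=
  Finset.univ.sup' ⟨∅, Finset.mem_univ _⟩ fun J : Finset (Fin n) => p.bundleUtil (J.erase i) x

/-- The greatest utility of a bundle with `i`, not counting the value of `i`. -/
noncomputable def utilWith (p : PriceSchedule n) (i : Fin n) (x : Fin n → ℝ) : ℝ :=
  Finset.univ.sup' ⟨∅, Finset.mem_univ _⟩ fun J : Finset (Fin n) =>
    ∑ j ∈ J.erase i, x j - p.price (insert i J)

@[fun_prop]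
theorem continuous_bundleUtil (p : PriceSchedule n) (J : Finset (Fin n)) :
    Continuous (p.bundleUtil J) := by
  unfold bundleUtil; fun_prop

@[fun_prop]
theorem continuous_util (p : PriceSchedule n) : Continuous p.util :=
  Continuous.finset_sup'_apply _ fun J _ => p.continuous_bundleUtil J

@[fun_prop]
theorem continuous_utilWithout (p : PriceSchedule n) (i : Fin n) : Continuous (p.utilWithout i) :=
  Continuous.finset_sup'_apply _ fun J _ => p.continuous_bundleUtil (J.erase i)

@[fun_prop]
theorem continuous_utilWith (p : PriceSchedule n) (i : Fin n) : Continuous (p.utilWith i) :=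
  Continuous.finset_sup'_apply _ fun J _ => by fun_prop

theorem bundleUtil_le_util (p : PriceSchedule n) (J : Finset (Fin n)) (x : Fin n → ℝ) :
    p.bundleUtil J x ≤ p.util x :=
  Finset.le_sup' (fun J => p.bundleUtil J x) (Finset.mem_univ J)

theorem util_le_iff (p : PriceSchedule n) (x : Fin n → ℝ) (c : ℝ) :
    p.util x ≤ c ↔ ∀ J, p.bundleUtil J x ≤ c := by
  exact (Finset.sup'_le_iff _ _).trans ⟨fun h J => h J (Finset.mem_univ J), fun h J _ => h J⟩

theorem exists_util_eq (p : PriceSchedule n) (x : Fin n → ℝ) :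
    ∃ J, p.util x = p.bundleUtil J x := by
  obtain ⟨J, -, h⟩ := Finset.exists_mem_eq_sup' (s := Finset.univ) ⟨∅, Finset.mem_univ _⟩
    fun J => p.bundleUtil J x
  exact ⟨J, h⟩

theorem bundleUtil_le_utilWithout (p : PriceSchedule n) {i : Fin n} {J : Finset (Fin n)}
    (hi : i ∉ J) (x : Fin n → ℝ) : p.bundleUtil J x ≤ p.utilWithout i x := by
  have := Finset.le_sup' (fun J : Finset (Fin n) => p.bundleUtil (J.erase i) x) (Finset.mem_univ J)
  rwa [Finset.erase_eq_of_notMem hi] at this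

theorem exists_utilWithout_eq (p : PriceSchedule n) (i : Fin n) (x : Fin n → ℝ) :
    ∃ J, i ∉ J ∧ p.utilWithout i x = p.bundleUtil J x := by
  obtain ⟨J, -, h⟩ := Finset.exists_mem_eq_sup' (s := Finset.univ) ⟨∅, Finset.mem_univ _⟩
    fun J : Finset (Fin n) => p.bundleUtil (J.erase i) x
  exact ⟨J.erase i, Finset.notMem_erase i J, h⟩

theorem bundleUtil_le_utilWith (p : PriceSchedule n) {i : Fin n} {J : Finset (Fin n)}
    (hi : i ∈ J) (x : Fin n → ℝ) : p.bundleUtil J x ≤ p.utilWith i x + x i := by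
  have := Finset.le_sup' (fun J : Finset (Fin n) => ∑ j ∈ J.erase i, x j - p.price (insert i J))
    (Finset.mem_univ J)
  rw [Finset.insert_eq_of_mem hi] at this
  have h2 := Finset.sum_erase_add J x hi
  simp only [bundleUtil, utilWith]
  linarith

theorem exists_utilWith_eq (p : PriceSchedule n) (i : Fin n) (x : Fin n → ℝ) :
    ∃ J, i ∈ J ∧ p.utilWith i x + x i = p.bundleUtil J x := by
  obtain ⟨J, -, h⟩ := Finset.exists_mem_eq_sup' (s := Finset.univ) ⟨∅, Finset.mem_univ _⟩
    fun J : Finset (Fin n) => ∑ j ∈ J.erase i, x j - p.price (insert i J)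
  refine ⟨insert i J, Finset.mem_insert_self i J, ?_⟩
  have h2 := Finset.sum_erase_add _ x (Finset.mem_insert_self i J)
  rw [Finset.erase_insert_eq_erase] at h2
  simp only [bundleUtil, utilWith]
  linarith

/-- Along the i-th axis the utility is thus the maximum of a constant and a line of slope one, the
form needed for integration by parts. -/
theorem util_eq_max (p : PriceSchedule n) (i : Fin n) (x : Fin n → ℝ) :
    p.util x = max (p.utilWithout i x) (p.utilWith i x + x i) := by
  apply le_antisymm
  · refine (p.util_le_iff x _).2 fun J => ?_
    by_cases hi : i ∈ J
    · exact le_max_of_le_right (p.bundleUtil_le_utilWith hi x)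
    · exact le_max_of_le_left (p.bundleUtil_le_utilWithout hi x)
  · obtain ⟨J, -, hJ⟩ := p.exists_utilWithout_eq i x
    obtain ⟨K, -, hK⟩ := p.exists_utilWith_eq i x
    rw [hJ, hK]
    exact max_le (p.bundleUtil_le_util J x) (p.bundleUtil_le_util K x)

theorem bundleUtil_congr (p : PriceSchedule n) {J : Finset (Fin n)} {x y : Fin n → ℝ}
    (h : ∀ j ∈ J, x j = y j) : p.bundleUtil J x = p.bundleUtil J y := by
  rw [bundleUtil, bundleUtil, Finset.sum_congr rfl h]

theorem utilWithout_update (p : PriceSchedule n) (i : Fin n) (x : Fin n → ℝ) (t : ℝ) :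
    p.utilWithout i (Function.update x i t) = p.utilWithout i x := by
  unfold utilWithout
  congr 1
  funext J
  exact p.bundleUtil_congr fun j hj => Function.update_of_ne (Finset.ne_of_mem_erase hj) _ _

theorem utilWith_update (p : PriceSchedule n) (i : Fin n) (x : Fin n → ℝ) (t : ℝ) :
    p.utilWith i (Function.update x i t) = p.utilWith i x := by
  unfold utilWith
  congr 1
  funext J
  rw [Finset.sum_congr rfl fun j hj => Function.update_of_ne (Finset.ne_of_mem_erase hj) _ _]

theorem util_update (p : PriceSchedule n) (i : Fin n) (x : Fin n → ℝ) (t : ℝ) :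
    p.util (Function.update x i t) = max (p.utilWithout i x) (p.utilWith i x + t) := by
  rw [p.util_eq_max i, utilWithout_update, utilWith_update, Function.update_self]

theorem mem_region_iff (p : PriceSchedule n) (I : Finset (Fin n)) (x : Fin n → ℝ) :
    x ∈ p.region I ↔ (∀ i, x i ∈ Icc (0 : ℝ) 1) ∧ p.util x = p.bundleUtil I x := by
  rw [(p.bundleUtil_le_util I x).ge_iff_eq'.symm, util_le_iff]
  rfl

theorem bundleUtil_update_of_mem (p : PriceSchedule n) {i : Fin n} {J : Finset (Fin n)}
    (hi : i ∈ J) (x : Fin n → ℝ) (t : ℝ) :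
    p.bundleUtil J (Function.update x i t) = p.bundleUtil J x + (t - x i) := by
  have h1 := Finset.sum_erase_add J (Function.update x i t) hi
  have h2 := Finset.sum_erase_add J x hi
  rw [Finset.sum_congr rfl fun j hj => Function.update_of_ne (Finset.ne_of_mem_erase hj) _ _,
    Function.update_self] at h1
  simp only [bundleUtil]
  linarith

theorem bundleUtil_update_of_notMem (p : PriceSchedule n) {i : Fin n} {J : Finset (Fin n)}
    (hi : i ∉ J) (x : Fin n → ℝ) (t : ℝ) :
    p.bundleUtil J (Function.update x i t) = p.bundleUtil J x :=
  p.bundleUtil_congr fun _ hj => Function.update_of_ne (ne_of_mem_of_not_mem hj hi) _ _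

theorem measure_tie_of_mem (p : PriceSchedule n) {J K : Finset (Fin n)} {i : Fin n} (hJ : i ∈ J)
    (hK : i ∉ K) : cubeMeasure (Fin n) {x | p.bundleUtil J x = p.bundleUtil K x} = 0 := by
  refine cubeMeasure_eq_zero_of_update i
    (isClosed_eq (p.continuous_bundleUtil J) (p.continuous_bundleUtil K)).measurableSet fun x =>
      ⟨p.bundleUtil K x - p.bundleUtil J x + x i, fun t ht => ?_⟩
  simp only [mem_ofPred_eq, p.bundleUtil_update_of_mem hJ, p.bundleUtil_update_of_notMem hK] at ht
  linarith

/-- Distinct bundles differ in some item, and along that axis their utilities agree at one point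
only. There are finitely many pairs. -/
theorem ae_bundleUtil_injective (p : PriceSchedule n) :
    ∀ᵐ x ∂cubeMeasure (Fin n), ∀ J K, p.bundleUtil J x = p.bundleUtil K x → J = K := by
  refine ae_all_iff.2 fun J => ae_all_iff.2 fun K => ?_
  by_cases h : J = K
  · exact Eventually.of_forall fun _ _ => h
  suffices hs : cubeMeasure (Fin n) {x | p.bundleUtil J x = p.bundleUtil K x} = 0 by
    refine measure_mono_null (fun x hx => ?_) hs
    simp only [mem_compl_iff, mem_ofPred_eq, Classical.not_imp] at hx
    exact hx.1
  obtain ⟨i, hi⟩ : ∃ i, ¬ (i ∈ J ↔ i ∈ K) := by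
    by_contra! hc
    exact h (Finset.ext hc)
  by_cases hJ : i ∈ J
  · exact p.measure_tie_of_mem hJ fun hK => hi (iff_of_true hJ hK)
  · have hK : i ∈ K := by tauto
    simpa only [eq_comm] using p.measure_tie_of_mem hK hJ

/-! ### Revenue in terms of the indirect utility -/

theorem regionVol_eq (p : PriceSchedule n) (I : Finset (Fin n)) :
    p.regionVol I = (cubeMeasure (Fin n)).real {x | p.util x = p.bundleUtil I x} := by
  rw [regionVol, volume_real_eq_cubeMeasure fun x hx => hx.1]
  refine measureReal_congr ?_
  filter_upwards [ae_mem_cube (Fin n)] with x hx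
  exact propext ((p.mem_region_iff I x).trans ⟨fun h => h.2, fun h => ⟨hx, h⟩⟩)

theorem measurableSet_util_eq (p : PriceSchedule n) (I : Finset (Fin n)) :
    MeasurableSet {x | p.util x = p.bundleUtil I x} :=
  (isClosed_eq p.continuous_util (p.continuous_bundleUtil I)).measurableSet

theorem measurable_mul_ite_utilWith (p : PriceSchedule n) (i : Fin n) :
    Measurable fun x : Fin n → ℝ =>
      x i * (if p.utilWithout i x < p.utilWith i x + x i then (1:ℝ) else 0) := by
  have hs : MeasurableSet {x : Fin n → ℝ | p.utilWithout i x < p.utilWith i x + x i} :=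
    measurableSet_lt (by fun_prop) (by fun_prop)
  exact (measurable_pi_apply i).mul (Measurable.ite hs measurable_const measurable_const)

theorem integrable_mul_ite_utilWith (p : PriceSchedule n) (i : Fin n) :
    Integrable (fun x : Fin n → ℝ =>
      x i * (if p.utilWithout i x < p.utilWith i x + x i then (1:ℝ) else 0))
      (cubeMeasure (Fin n)) := by
  refine (integrable_const 1).mono' (p.measurable_mul_ite_utilWith i).aestronglyMeasurable ?_
  filter_upwards [ae_mem_cube (Fin n)] with x hx
  have h0 := (hx i).1
  have h1 := (hx i).2
  split_ifs <;> simp [abs_of_nonneg, *]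

/-- The indicator is the derivative of the utility along the i-th axis, away from the kink.
Integration by parts leaves the boundary term at 1, as the factor xᵢ kills the one at 0. -/
theorem integral_mul_ite_utilWith (p : PriceSchedule n) (i : Fin n) :
    ∫ x, x i * (if p.utilWithout i x < p.utilWith i x + x i then 1 else 0) ∂cubeMeasure (Fin n) =
      ∫ x, p.util (Function.update x i 1) ∂cubeMeasure (Fin n) -
        ∫ x, p.util x ∂cubeMeasure (Fin n) := by
  have hm := p.measurable_mul_ite_utilWith i
  have hi := p.integrable_mul_ite_utilWith i
  have hu := integrable_cubeMeasure_of_continuous p.continuous_util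
  have h2 : Integrable (fun x => p.util x + x i *
      (if p.utilWithout i x < p.utilWith i x + x i then (1:ℝ) else 0)) (cubeMeasure (Fin n)) :=
    hu.add hi
  rw [eq_sub_iff_add_eq', ← integral_add hu hi,
    integral_update i (f := fun x => p.util x + x i * _)
      (p.continuous_util.measurable.add hm) h2]
  refine integral_congr_ae (Eventually.of_forall fun x => ?_)
  simp only [util_update, utilWithout_update, utilWith_update, Function.update_self]
  rw [← integral_Icc_mul_ite_add_integral_max, add_comm, ← integral_add]
  · exact (by fun_prop : Continuous fun t : ℝ => max (p.utilWithout i x)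
      (p.utilWith i x + t)).continuousOn.integrableOn_Icc
  · have : Integrable (fun t : ℝ => if p.utilWithout i x < p.utilWith i x + t then (1:ℝ) else 0)
        (volume.restrict (Icc (0 : ℝ) 1)) := by
      have hs : MeasurableSet {t : ℝ | p.utilWithout i x < p.utilWith i x + t} :=
        measurableSet_lt (by fun_prop) (by fun_prop)
      refine ((integrable_const (1:ℝ)).indicator hs).congr (Eventually.of_forall fun t => ?_)
      simp [indicator]
    exact IntegrableOn.continuousOn_mul continuousOn_id this isCompact_Icc

/-- The expected revenue as a linear functional of the indirect utility. -/
theorem revenue_eq (p : PriceSchedule n) :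
    p.revenue = ∑ i, ∫ x, p.util (Function.update x i 1) ∂cubeMeasure (Fin n) -
      (n + 1) * ∫ x, p.util x ∂cubeMeasure (Fin n) := by
  have hint := p.integrable_mul_ite_utilWith
  have h1 : p.revenue = ∫ x, ∑ I, p.price I *
      indicator {x | p.util x = p.bundleUtil I x} 1 x ∂cubeMeasure (Fin n) := by
    rw [integral_finsetSum _ fun I _ =>
      ((integrable_const 1).indicator (p.measurableSet_util_eq I)).const_mul _]
    refine Finset.sum_congr rfl fun I _ => ?_
    rw [integral_const_mul, integral_indicator_one (p.measurableSet_util_eq I), regionVol_eq]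
  -- Off ties a single bundle K is bought, and its price is the sum of the xᵢ over K minus the
  -- utility.
  have h2 : p.revenue = ∫ x, (∑ i,
      x i * (if p.utilWithout i x < p.utilWith i x + x i then (1:ℝ) else 0)) - p.util x
        ∂cubeMeasure (Fin n) := by
    rw [h1]
    refine integral_congr_ae ?_
    filter_upwards [p.ae_bundleUtil_injective] with x hx
    obtain ⟨K, hK⟩ := p.exists_util_eq x
    have e1 : ∀ I, indicator {x | p.util x = p.bundleUtil I x} (1 : (Fin n → ℝ) → ℝ) x =
        if I = K then 1 else 0 := by
      intro I
      by_cases h : I = K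
      · subst h; simp [hK]
      · rw [if_neg h, indicator_of_notMem]
        intro hm
        exact h (hx _ _ (hm.symm.trans hK))
    have e2 : ∀ i, (p.utilWithout i x < p.utilWith i x + x i) ↔ i ∈ K := by
      intro i
      constructor
      · intro h
        by_contra hi
        have a1 := p.bundleUtil_le_utilWithout hi x
        obtain ⟨J, -, hJ⟩ := p.exists_utilWith_eq i x
        have a2 := p.bundleUtil_le_util J x
        linarith
      · intro hi
        obtain ⟨J, hiJ, hJ⟩ := p.exists_utilWithout_eq i x
        have a1 := p.bundleUtil_le_utilWith hi x
        have a2 := p.bundleUtil_le_util J x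
        have a3 : p.bundleUtil J x ≠ p.bundleUtil K x := fun h => hiJ (hx _ _ h ▸ hi)
        rw [hJ]
        rw [hK] at a2
        exact (lt_of_le_of_ne a2 a3).trans_le a1
    simp_rw [e1, e2]
    simp only [mul_ite, mul_one, mul_zero, Finset.sum_ite_eq', Finset.mem_univ, if_true,
      Finset.sum_ite_mem, Finset.univ_inter, hK, bundleUtil]
    ring
  rw [h2, integral_sub (integrable_finsetSum _ fun i _ => hint i)
    (integrable_cubeMeasure_of_continuous p.continuous_util),
    integral_finsetSum _ fun i _ => hint i]
  simp only [integral_mul_ite_utilWith, Finset.sum_sub_distrib, Finset.sum_const,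
    Finset.card_univ, Fintype.card_fin, nsmul_eq_mul]
  ring


/-! ### Perturbing the price of one bundle -/

/-- The price schedule in which the price of the nonempty bundle `I` is changed by `t`. -/
def shift (p : PriceSchedule n) {I : Finset (Fin n)} (hI : I.Nonempty) (t : ℝ) :
    PriceSchedule n where
  price J := p.price J + if J = I then t else 0
  price_empty := by rw [if_neg hI.ne_empty.symm, p.price_empty, add_zero]

/-- Lowering the price of I threatens only the inequalities with I on the right. For incomparable
pairs these are strict, and there are finitely many. -/
theorem eventually_isSubmodular_shift_neg {p : PriceSchedule n} (hp : p.IsSubmodular)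
    {I : Finset (Fin n)} (hI : I.Nonempty) (h : ¬ p.RightTight I) :
    ∀ᶠ s in 𝓝[>] (0 : ℝ), (p.shift hI (-s)).IsSubmodular := by
  refine eventually_all.2 fun A => eventually_all.2 fun B => ?_
  by_cases hAB : A ⊆ B
  · exact Eventually.of_forall fun s => by
      rw [Finset.union_eq_right.2 hAB, Finset.inter_eq_left.2 hAB, add_comm]
  by_cases hBA : B ⊆ A
  · exact Eventually.of_forall fun s => by
      rw [Finset.union_eq_left.2 hBA, Finset.inter_eq_right.2 hBA]
  have h0 := hp A B
  by_cases hI' : I = A ∨ I = B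
  -- Half the slack also closes the branch of the case split in which both A and B equal I, losing
  -- 2s.
  · have hlt : 0 < (p.price A + p.price B - (p.price (A ∪ B) + p.price (A ∩ B))) / 2 := by
      have hne : p.price (A ∪ B) + p.price (A ∩ B) ≠ p.price A + p.price B :=
        fun he => h ⟨A, B, ⟨hAB, hBA, he⟩, hI'⟩
      have := lt_of_le_of_ne h0 hne
      linarith
    filter_upwards [Ioo_mem_nhdsGT hlt] with s hs
    obtain ⟨hs0, hs1⟩ := hs
    simp only [shift]
    split_ifs <;> linarith
  · filter_upwards [self_mem_nhdsWithin] with s hs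
    have hs : 0 < s := hs
    push Not at hI'
    simp only [shift, if_neg hI'.1.symm, if_neg hI'.2.symm]
    split_ifs <;> linarith

theorem eventually_isSubmodular_shift {p : PriceSchedule n} (hp : p.IsSubmodular)
    {I : Finset (Fin n)} (hI : I.Nonempty) (h : ¬ p.LeftTight I) :
    ∀ᶠ s in 𝓝[>] (0 : ℝ), (p.shift hI s).IsSubmodular := by
  refine eventually_all.2 fun A => eventually_all.2 fun B => ?_
  by_cases hAB : A ⊆ B
  · exact Eventually.of_forall fun s => by
      rw [Finset.union_eq_right.2 hAB, Finset.inter_eq_left.2 hAB, add_comm]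
  by_cases hBA : B ⊆ A
  · exact Eventually.of_forall fun s => by
      rw [Finset.union_eq_left.2 hBA, Finset.inter_eq_right.2 hBA]
  have h0 := hp A B
  by_cases hI' : I = A ∪ B ∨ I = A ∩ B
  · have hlt : 0 < (p.price A + p.price B - (p.price (A ∪ B) + p.price (A ∩ B))) / 2 := by
      have hne : p.price (A ∪ B) + p.price (A ∩ B) ≠ p.price A + p.price B :=
        fun he => h ⟨A, B, ⟨hAB, hBA, he⟩, hI'⟩
      have := lt_of_le_of_ne h0 hne
      linarith
    filter_upwards [Ioo_mem_nhdsGT hlt] with s hs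
    obtain ⟨hs0, hs1⟩ := hs
    simp only [shift]
    split_ifs <;> linarith
  · filter_upwards [self_mem_nhdsWithin] with s hs
    have hs : 0 < s := hs
    push Not at hI'
    simp only [shift, if_neg hI'.1.symm, if_neg hI'.2.symm]
    split_ifs <;> linarith

theorem bundleUtil_shift_self (p : PriceSchedule n) {I : Finset (Fin n)} (hI : I.Nonempty) (t : ℝ)
    (x : Fin n → ℝ) : (p.shift hI t).bundleUtil I x = p.bundleUtil I x - t := by
  simp only [bundleUtil, shift, if_true]; ring

theorem bundleUtil_shift_of_ne (p : PriceSchedule n) {I J : Finset (Fin n)} (hI : I.Nonempty)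
    (hJ : J ≠ I) (t : ℝ) (x : Fin n → ℝ) : (p.shift hI t).bundleUtil J x = p.bundleUtil J x := by
  simp only [bundleUtil, shift, if_neg hJ, add_zero]

theorem util_shift_neg (p : PriceSchedule n) {I : Finset (Fin n)} (hI : I.Nonempty) {s : ℝ}
    (hs : 0 ≤ s) (x : Fin n → ℝ) :
    (p.shift hI (-s)).util x = max (p.util x) (p.bundleUtil I x + s) := by
  have hI1 := p.bundleUtil_shift_self hI (-s) x
  have hI2 := (p.shift hI (-s)).bundleUtil_le_util I x
  apply le_antisymm
  · refine (util_le_iff _ x _).2 fun J => ?_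
    by_cases hJ : J = I
    · subst hJ
      exact le_max_of_le_right (by linarith)
    · rw [p.bundleUtil_shift_of_ne hI hJ]
      exact le_max_of_le_left (p.bundleUtil_le_util J x)
  · refine max_le ((util_le_iff _ x _).2 fun J => ?_) (by linarith)
    by_cases hJ : J = I
    · subst hJ; linarith
    · rw [← p.bundleUtil_shift_of_ne hI hJ (-s)]
      exact bundleUtil_le_util _ J x

/-! ### Splitting optimality into conditions below and above a bundle -/

/-- The valuations for which no bundle contained in `I` is better than `I` by more than `s`. -/
def nearOptBelow (p : PriceSchedule n) (I : Finset (Fin n)) (s : ℝ) : Set (Fin n → ℝ) :=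
  {x | ∀ J ⊆ I, p.bundleUtil J x ≤ p.bundleUtil I x + s}

/-- The greatest gain in utility from enlarging the bundle `I`. -/
noncomputable def gainAbove (p : PriceSchedule n) (I : Finset (Fin n)) (x : Fin n → ℝ) : ℝ :=
  Finset.univ.sup' ⟨∅, Finset.mem_univ _⟩ fun J : Finset (Fin n) =>
    ∑ j ∈ J \ I, x j - (p.price (I ∪ J) - p.price I)

theorem bundleUtil_union_sub (p : PriceSchedule n) (I J : Finset (Fin n)) (x : Fin n → ℝ) :
    p.bundleUtil (I ∪ J) x - p.bundleUtil I x =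
      ∑ j ∈ J \ I, x j - (p.price (I ∪ J) - p.price I) := by
  rw [bundleUtil, bundleUtil, ← Finset.union_sdiff_self_eq_union,
    Finset.sum_union Finset.disjoint_sdiff]
  ring

theorem bundleUtil_le_add_gainAbove (p : PriceSchedule n) {I J : Finset (Fin n)} (h : I ⊆ J)
    (x : Fin n → ℝ) : p.bundleUtil J x ≤ p.bundleUtil I x + p.gainAbove I x := by
  have h1 := Finset.le_sup' (fun J : Finset (Fin n) =>
    ∑ j ∈ J \ I, x j - (p.price (I ∪ J) - p.price I)) (Finset.mem_univ J)
  rw [← bundleUtil_union_sub, Finset.union_eq_right.2 h] at h1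
  unfold gainAbove
  linarith

theorem gainAbove_le_iff (p : PriceSchedule n) (I : Finset (Fin n)) (x : Fin n → ℝ) (c : ℝ) :
    p.gainAbove I x ≤ c ↔ ∀ J, I ⊆ J → p.bundleUtil J x ≤ p.bundleUtil I x + c := by
  constructor
  · intro h J hJ
    have := p.bundleUtil_le_add_gainAbove hJ x
    linarith
  · intro h
    refine Finset.sup'_le _ _ fun J _ => ?_
    rw [← bundleUtil_union_sub]
    have := h (I ∪ J) Finset.subset_union_left
    linarith

theorem gainAbove_nonneg (p : PriceSchedule n) (I : Finset (Fin n)) (x : Fin n → ℝ) :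
    0 ≤ p.gainAbove I x := by
  have := p.bundleUtil_le_add_gainAbove (Finset.Subset.refl I) x
  linarith

theorem gainAbove_congr (p : PriceSchedule n) {I : Finset (Fin n)} {x y : Fin n → ℝ}
    (h : ∀ j ∉ I, x j = y j) : p.gainAbove I x = p.gainAbove I y := by
  unfold gainAbove
  congr 1
  funext J
  rw [Finset.sum_congr rfl fun j hj => h j (Finset.mem_sdiff.1 hj).2]

theorem mem_nearOptBelow_congr (p : PriceSchedule n) {I : Finset (Fin n)} {s : ℝ} {x y : Fin n → ℝ}
    (h : ∀ j ∈ I, x j = y j) : x ∈ p.nearOptBelow I s ↔ y ∈ p.nearOptBelow I s := by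
  refine forall₂_congr fun J hJ => ?_
  rw [p.bundleUtil_congr h, p.bundleUtil_congr fun j hj => h j (hJ hj)]

@[fun_prop]
theorem continuous_gainAbove (p : PriceSchedule n) (I : Finset (Fin n)) :
    Continuous (p.gainAbove I) :=
  Continuous.finset_sup'_apply _ fun J _ => by fun_prop

theorem isClosed_nearOptBelow (p : PriceSchedule n) (I : Finset (Fin n)) (s : ℝ) :
    IsClosed (p.nearOptBelow I s) := by
  have : p.nearOptBelow I s =
      ⋂ J, ⋂ (_ : J ⊆ I), {x | p.bundleUtil J x ≤ p.bundleUtil I x + s} := by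
    ext x; simp [nearOptBelow]
  rw [this]
  exact isClosed_iInter fun J => isClosed_iInter fun _ => isClosed_le (by fun_prop) (by fun_prop)

/-- The value of a bundle is modular, so submodular prices make utility supermodular in the bundle.
-/
theorem IsSubmodular.bundleUtil_add_le {p : PriceSchedule n} (hp : p.IsSubmodular)
    (I J : Finset (Fin n)) (x : Fin n → ℝ) :
    p.bundleUtil I x + p.bundleUtil J x ≤ p.bundleUtil (I ∪ J) x + p.bundleUtil (I ∩ J) x := by
  have h1 := hp I J
  have h2 := Finset.sum_union_inter (s₁ := I) (s₂ := J) (f := x)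
  simp only [bundleUtil]
  linarith

/-- For submodular prices, optimality among all bundles follows from optimality among those
that are comparable with `I`. -/
theorem IsSubmodular.util_eq_iff {p : PriceSchedule n} (hp : p.IsSubmodular) (I : Finset (Fin n))
    (x : Fin n → ℝ) :
    p.util x = p.bundleUtil I x ↔ x ∈ p.nearOptBelow I 0 ∧ p.gainAbove I x ≤ 0 := by
  rw [(p.bundleUtil_le_util I x).ge_iff_eq'.symm, util_le_iff, gainAbove_le_iff]
  constructor
  · exact fun h => ⟨fun J _ => by linarith [h J], fun J _ => by linarith [h J]⟩
  · rintro ⟨h1, h2⟩ J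
    have e1 := h1 (I ∩ J) Finset.inter_subset_left
    have e2 := h2 (I ∪ J) Finset.subset_union_left
    have := hp.bundleUtil_add_le I J x
    linarith

/-- If the price of `I` can be lowered by `s` with the prices staying submodular, then lowering it
raises the utility at least by the margin by which `I` then beats the bundles above it. -/
theorem sub_gainAbove_le_util_shift_neg_sub {p : PriceSchedule n} {I : Finset (Fin n)}
    (hI : I.Nonempty) {s : ℝ} (hs : 0 ≤ s) (hq : (p.shift hI (-s)).IsSubmodular) {x : Fin n → ℝ}
    (hx : x ∈ p.nearOptBelow I 0) :
    max 0 (s - p.gainAbove I x) ≤ (p.shift hI (-s)).util x - p.util x := by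
  rw [util_shift_neg p hI hs]
  refine max_le (sub_nonneg.2 (le_max_left _ _)) ?_
  by_cases hg : s ≤ p.gainAbove I x
  · have := le_max_left (p.util x) (p.bundleUtil I x + s)
    linarith
  push Not at hg
  have hg0 := p.gainAbove_nonneg I x
  suffices h : p.util x ≤ p.bundleUtil I x + p.gainAbove I x by
    have := le_max_right (p.util x) (p.bundleUtil I x + s)
    linarith
  refine (p.util_le_iff x _).2 fun J => ?_
  by_cases hIJ : I ⊆ J
  · exact p.bundleUtil_le_add_gainAbove hIJ x
  by_cases hJI : J ⊆ I
  · have := hx J hJI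
    linarith
  -- An incomparable J is controlled by its meet and join with I through supermodularity.
  have e1 := hx (I ∩ J) Finset.inter_subset_left
  have e2 := p.bundleUtil_le_add_gainAbove (Finset.subset_union_left (s₁ := I) (s₂ := J)) x
  have e3 := hq.bundleUtil_add_le I J x
  rw [bundleUtil_shift_self, bundleUtil_shift_of_ne p hI fun h => hJI h.le,
    bundleUtil_shift_of_ne p hI fun h => hJI (Finset.union_eq_left.1 h),
    bundleUtil_shift_of_ne p hI fun h => hIJ (Finset.inter_eq_left.1 h)] at e3
  linarith

/-- If the discount helps at x, no bundle beats I by more than s there. The gain is s minus the lead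
of the old optimum over I, and that lead is at least `gainAbove`. -/
theorem util_shift_neg_sub_le (p : PriceSchedule n) {I : Finset (Fin n)} (hI : I.Nonempty) {s : ℝ}
    (hs : 0 ≤ s) (x : Fin n → ℝ) :
    (p.shift hI (-s)).util x - p.util x ≤
      (p.nearOptBelow I s).indicator 1 x * max 0 (s - p.gainAbove I x) := by
  rw [util_shift_neg p hI hs]
  by_cases h : p.bundleUtil I x + s ≤ p.util x
  · rw [max_eq_left h, sub_self]
    exact mul_nonneg (indicator_nonneg (fun _ _ => zero_le_one) _) (le_max_left _ _)
  · push Not at h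
    rw [max_eq_right h.le, indicator_of_mem, Pi.one_apply, one_mul]
    · refine le_max_of_le_right ?_
      have : p.gainAbove I x ≤ p.util x - p.bundleUtil I x :=
        (p.gainAbove_le_iff I x _).2 fun J _ => by linarith [p.bundleUtil_le_util J x]
      linarith
    · exact fun J _ => (p.bundleUtil_le_util J x).trans h.le

theorem integrable_util_update (p : PriceSchedule n) (i : Fin n) :
    Integrable (fun x => p.util (Function.update x i 1)) (cubeMeasure (Fin n)) :=
  integrable_cubeMeasure_of_continuous (by fun_prop)

theorem revenue_le_iff (p q : PriceSchedule n) :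
    q.revenue ≤ p.revenue ↔
    ∑ i, ∫ x, (q.util (Function.update x i 1) - p.util (Function.update x i 1))
        ∂cubeMeasure (Fin n) ≤
      (n + 1) * ∫ x, (q.util x - p.util x) ∂cubeMeasure (Fin n) := by
  have h : ∀ i, ∫ x, (q.util (Function.update x i 1) - p.util (Function.update x i 1))
        ∂cubeMeasure (Fin n) = ∫ x, q.util (Function.update x i 1) ∂cubeMeasure (Fin n) -
          ∫ x, p.util (Function.update x i 1) ∂cubeMeasure (Fin n) := fun i =>
    integral_sub (q.integrable_util_update i) (p.integrable_util_update i)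
  rw [revenue_eq, revenue_eq, Finset.sum_congr rfl fun i _ => h i, Finset.sum_sub_distrib,
    integral_sub (integrable_cubeMeasure_of_continuous q.continuous_util)
      (integrable_cubeMeasure_of_continuous p.continuous_util)]
  constructor <;> intro h <;> linarith

end PriceSchedule

/-! ### Positivity and product formulas for integrals -/

theorem integral_cubeMeasure_pos {ι : Type*} [Fintype ι] {f : (ι → ℝ) → ℝ} (hf : Continuous f)
    (h0 : ∀ x, 0 ≤ f x) (hpos : 0 < f 0) : 0 < ∫ x, f x ∂cubeMeasure ι := by
  rw [integral_pos_iff_support_of_nonneg h0 (integrable_cubeMeasure_of_continuous hf)]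
  obtain ⟨ε, hε, hb⟩ := Metric.mem_nhds_iff.1 (hf.continuousAt.eventually (lt_mem_nhds hpos))
  have hsub : univ.pi (fun _ : ι => Ioo (0:ℝ) (min ε 1)) ⊆ Function.support f := by
    intro x hx
    refine ne_of_gt (hb ?_)
    rw [mem_ball_zero_iff, pi_norm_lt_iff hε]
    intro i
    have h : x i ∈ Ioo (0:ℝ) (min ε 1) := hx i (mem_univ i)
    rw [Real.norm_eq_abs, abs_of_pos h.1]
    exact h.2.trans_le (min_le_left _ _)
  refine lt_of_lt_of_le ?_ (measure_mono hsub)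
  rw [cubeMeasure, Measure.pi_pi]
  refine pos_iff_ne_zero.2 (Finset.prod_ne_zero_iff.2 fun i _ => ne_of_gt ?_)
  have hs : Ioo (0:ℝ) (min ε 1) ⊆ Icc 0 1 := fun t ht =>
    ⟨ht.1.le, ht.2.le.trans (min_le_right _ _)⟩
  rw [Measure.restrict_eq_self _ hs, Real.volume_Ioo]
  simp [hε]

theorem integrable_indicator_one_mul {ι : Type*} [Fintype ι] {s : Set (ι → ℝ)} {g : (ι → ℝ) → ℝ}
    (hs : MeasurableSet s) (hg : Continuous g) :
    Integrable (fun x => s.indicator 1 x * g x) (cubeMeasure ι) := by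
  refine ((integrable_cubeMeasure_of_continuous hg).indicator hs).congr
    (Eventually.of_forall fun x => ?_)
  by_cases h : x ∈ s <;> simp [h]

theorem measureReal_inter_of_piecewise {ι : Type*} [Fintype ι] [DecidableEq ι] (I : Finset ι)
    {s t : Set (ι → ℝ)} (hs : MeasurableSet s) (ht : MeasurableSet t)
    (hsI : ∀ x y, I.piecewise y x ∈ s ↔ y ∈ s) (htI : ∀ x y, I.piecewise y x ∈ t ↔ x ∈ t) :
    (cubeMeasure ι).real (s ∩ t) = (cubeMeasure ι).real s * (cubeMeasure ι).real t := by
  have hmul : ∀ x, (s ∩ t).indicator (1 : (ι → ℝ) → ℝ) x = s.indicator 1 x * t.indicator 1 x := by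
    intro x
    rw [inter_indicator_one, Pi.mul_apply]
  have hi : Integrable ((s ∩ t).indicator (1 : (ι → ℝ) → ℝ)) (cubeMeasure ι) :=
    (integrable_const 1).indicator (hs.inter ht)
  rw [← integral_indicator_one hs, ← integral_indicator_one ht,
    ← integral_indicator_one (hs.inter ht), ← integral_mul_of_piecewise I]
  · exact integral_congr_ae (Eventually.of_forall hmul)
  · exact hi.congr (Eventually.of_forall hmul)
  · intro x y; exact indicator_const_eq_indicator_const (hsI x y)
  · intro x y; exact indicator_const_eq_indicator_const (htI x y)

theorem integral_indicator_mul_of_piecewise {ι : Type*} [Fintype ι] [DecidableEq ι] (I : Finset ι)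
    {s : Set (ι → ℝ)} {g : (ι → ℝ) → ℝ} (hs : MeasurableSet s) (hg : Continuous g)
    (hsI : ∀ x y, I.piecewise y x ∈ s ↔ y ∈ s) (hgI : ∀ x y, g (I.piecewise y x) = g x) :
    ∫ x, s.indicator 1 x * g x ∂cubeMeasure ι =
      (cubeMeasure ι).real s * ∫ x, g x ∂cubeMeasure ι := by
  rw [integral_mul_of_piecewise I _ _ hgI, integral_indicator_one hs]
  · exact integrable_indicator_one_mul hs hg
  · intro x y; exact indicator_const_eq_indicator_const (hsI x y)

theorem tendsto_one_div_add_one_nhdsGT :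
    Tendsto (fun k : ℕ => 1 / ((k : ℝ) + 1)) atTop (𝓝[>] 0) :=
  tendsto_nhdsWithin_iff.2 ⟨tendsto_one_div_add_atTop_nhds_zero_nat,
    Eventually.of_forall fun _ => mem_Ioi.2 Nat.one_div_pos_of_nat⟩

namespace PriceSchedule

variable {n : ℕ}

/-! ### Lowering a price -/

theorem price_le_of_region_nonempty (p : PriceSchedule n) {I J : Finset (Fin n)}
    (h : (p.region I).Nonempty) : p.price I ≤ p.price (I ∪ J) := by
  obtain ⟨x, hx, hJ⟩ := h
  have h1 : p.bundleUtil (I ∪ J) x ≤ p.bundleUtil I x := hJ (I ∪ J)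
  have h2 := p.bundleUtil_union_sub I J x
  have h3 : 0 ≤ ∑ j ∈ J \ I, x j := Finset.sum_nonneg fun j _ => (hx j).1
  linarith

/-- At the origin no enlargement of I pays, since a bundle that is optimal somewhere costs no more
than its supersets. A nonempty region suffices, so null regions are covered. -/
theorem integral_sub_gainAbove_pos (p : PriceSchedule n) {I : Finset (Fin n)}
    (h : (p.region I).Nonempty) {s : ℝ} (hs : 0 < s) :
    0 < ∫ x, max 0 (s - p.gainAbove I x) ∂cubeMeasure (Fin n) := by
  refine integral_cubeMeasure_pos (by fun_prop) (fun x => le_max_left _ _) ?_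
  have : p.gainAbove I 0 ≤ 0 := by
    refine Finset.sup'_le _ _ fun J _ => ?_
    have := p.price_le_of_region_nonempty (J := J) h
    simp only [Pi.zero_apply, Finset.sum_const_zero]
    linarith
  exact lt_max_of_lt_right (by linarith)

theorem update_mem_nearOptBelow_piecewise (p : PriceSchedule n) {I : Finset (Fin n)} (i : Fin n)
    (s t : ℝ) (x y : Fin n → ℝ) :
    Function.update (I.piecewise y x) i t ∈ p.nearOptBelow I s ↔
      Function.update y i t ∈ p.nearOptBelow I s := by
  refine p.mem_nearOptBelow_congr fun j hj => ?_
  by_cases h : j = i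
  · subst h; simp
  · simp [h, hj]

theorem gainAbove_piecewise (p : PriceSchedule n) (I : Finset (Fin n)) (x y : Fin n → ℝ) :
    p.gainAbove I (I.piecewise y x) = p.gainAbove I x :=
  p.gainAbove_congr fun _ hj => Finset.piecewise_eq_of_notMem _ _ _ hj

theorem gainAbove_update (p : PriceSchedule n) {I : Finset (Fin n)} {i : Fin n} (hi : i ∈ I)
    (x : Fin n → ℝ) (t : ℝ) : p.gainAbove I (Function.update x i t) = p.gainAbove I x :=
  p.gainAbove_congr fun _ hj => Function.update_of_ne (ne_of_mem_of_not_mem hi hj).symm _ _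

theorem measurableSet_update_nearOptBelow (p : PriceSchedule n) (I : Finset (Fin n)) (i : Fin n)
    (s t : ℝ) : MeasurableSet {x | Function.update x i t ∈ p.nearOptBelow I s} :=
  ((p.isClosed_nearOptBelow I s).preimage
    (by fun_prop : Continuous fun x : Fin n → ℝ => Function.update x i t)).measurableSet

/-- Both bounds on the utility gain have the factor ψ, which ignores the coordinates in I. Its
positive integral splits off and cancels, so no rate in s is needed. Face terms with i ∉ I are
nonnegative and are dropped. -/
theorem sum_measure_update_le_of_shift_neg {p : PriceSchedule n} {I : Finset (Fin n)}
    (hI : I.Nonempty) (hne : (p.region I).Nonempty) {s : ℝ} (hs : 0 < s)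
    (hq : (p.shift hI (-s)).IsSubmodular) (hrev : (p.shift hI (-s)).revenue ≤ p.revenue) :
    ∑ i ∈ I, (cubeMeasure (Fin n)).real {x | Function.update x i 1 ∈ p.nearOptBelow I 0} ≤
      (n + 1) * (cubeMeasure (Fin n)).real (p.nearOptBelow I s) := by
  rw [revenue_le_iff] at hrev
  set q := p.shift hI (-s) with hqdef
  have hpos := p.integral_sub_gainAbove_pos hne hs
  set ψ : (Fin n → ℝ) → ℝ := fun x => max 0 (s - p.gainAbove I x) with hψ
  have hψc : Continuous ψ := by fun_prop
  have hψI : ∀ x y, ψ (I.piecewise y x) = ψ x := fun x y => by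
    simp only [hψ, gainAbove_piecewise]
  have hw0 : ∀ x, 0 ≤ q.util x - p.util x := fun x => by
    rw [hqdef, util_shift_neg p hI hs.le]
    exact sub_nonneg.2 (le_max_left _ _)
  have hup : ∫ x, (q.util x - p.util x) ∂cubeMeasure (Fin n) ≤
      (cubeMeasure (Fin n)).real (p.nearOptBelow I s) * ∫ x, ψ x ∂cubeMeasure (Fin n) := by
    have hm := (p.isClosed_nearOptBelow I s).measurableSet
    rw [← integral_indicator_mul_of_piecewise I hm hψc
      (fun x y => p.mem_nearOptBelow_congr fun j hj => Finset.piecewise_eq_of_mem _ _ _ hj) hψI]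
    exact integral_mono (integrable_cubeMeasure_of_continuous (by fun_prop))
      (integrable_indicator_one_mul hm hψc) fun x => p.util_shift_neg_sub_le hI hs.le x
  have hlow : ∀ i ∈ I,
      (cubeMeasure (Fin n)).real {x | Function.update x i 1 ∈ p.nearOptBelow I 0} *
        ∫ x, ψ x ∂cubeMeasure (Fin n) ≤
      ∫ x, (q.util (Function.update x i 1) - p.util (Function.update x i 1))
        ∂cubeMeasure (Fin n) := by
    intro i hi
    have hm := p.measurableSet_update_nearOptBelow I i 0 1
    rw [← integral_indicator_mul_of_piecewise I hm hψc
      (fun x y => p.update_mem_nearOptBelow_piecewise i 0 1 x y) hψI]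
    refine integral_mono (integrable_indicator_one_mul hm hψc)
      ((q.integrable_util_update i).sub (p.integrable_util_update i)) fun x => ?_
    by_cases hx : Function.update x i 1 ∈ p.nearOptBelow I 0
    · have := sub_gainAbove_le_util_shift_neg_sub hI hs.le hq hx
      rw [gainAbove_update p hi] at this
      rw [indicator_of_mem (by exact hx), Pi.one_apply, one_mul]
      exact this
    · simpa [indicator, hx] using hw0 (Function.update x i 1)
  have hsum : ∑ i ∈ I, ∫ x, (q.util (Function.update x i 1) - p.util (Function.update x i 1))
        ∂cubeMeasure (Fin n) ≤
      ∑ i, ∫ x, (q.util (Function.update x i 1) - p.util (Function.update x i 1))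
        ∂cubeMeasure (Fin n) :=
    Finset.sum_le_sum_of_subset_of_nonneg (Finset.subset_univ I)
      fun i _ _ => integral_nonneg fun x => hw0 _
  refine le_of_mul_le_mul_right ?_ hpos
  calc _ = ∑ i ∈ I, (cubeMeasure (Fin n)).real
        {x | Function.update x i 1 ∈ p.nearOptBelow I 0} * ∫ x, ψ x ∂cubeMeasure (Fin n) :=
        Finset.sum_mul _ _ _
    _ ≤ _ := Finset.sum_le_sum hlow
    _ ≤ _ := hsum.trans hrev
    _ ≤ (n + 1) * ((cubeMeasure (Fin n)).real (p.nearOptBelow I s) *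
          ∫ x, ψ x ∂cubeMeasure (Fin n)) := by gcongr
    _ = _ := by ring

theorem tendsto_measureReal_nearOptBelow (p : PriceSchedule n) (I : Finset (Fin n)) :
    Tendsto (fun k : ℕ => (cubeMeasure (Fin n)).real (p.nearOptBelow I (1 / ((k : ℝ) + 1)))) atTop
      (𝓝 ((cubeMeasure (Fin n)).real (p.nearOptBelow I 0))) := by
  have hInter : p.nearOptBelow I 0 = ⋂ k : ℕ, p.nearOptBelow I (1 / ((k : ℝ) + 1)) := by
    ext x
    simp only [mem_iInter]
    constructor
    · intro h k J hJ
      have := h J hJ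
      have : 0 < 1 / ((k : ℝ) + 1) := Nat.one_div_pos_of_nat
      linarith
    · intro h J hJ
      exact ge_of_tendsto' (tendsto_one_div_add_atTop_nhds_zero_nat.const_add _) fun k => h k J hJ
  rw [hInter]
  refine (ENNReal.tendsto_toReal (measure_ne_top _ _)).comp
    (tendsto_measure_iInter_atTop
      (fun k => (p.isClosed_nearOptBelow I _).measurableSet.nullMeasurableSet) ?_
      ⟨0, measure_ne_top _ _⟩)
  intro k l hkl x hx J hJ
  have := hx J hJ
  have := Nat.one_div_le_one_div (α := ℝ) hkl
  linarith

theorem sum_measure_update_le {p : PriceSchedule n} (hp : p.IsSubmodular)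
    (hmax : ∀ q : PriceSchedule n, q.IsSubmodular → q.revenue ≤ p.revenue) {I : Finset (Fin n)}
    (hI : I.Nonempty) (hne : (p.region I).Nonempty) (hr : ¬ p.RightTight I) :
    ∑ i ∈ I, (cubeMeasure (Fin n)).real {x | Function.update x i 1 ∈ p.nearOptBelow I 0} ≤
      (n + 1) * (cubeMeasure (Fin n)).real (p.nearOptBelow I 0) := by
  refine ge_of_tendsto ((p.tendsto_measureReal_nearOptBelow I).const_mul _) ?_
  filter_upwards [tendsto_one_div_add_one_nhdsGT.eventually
    (eventually_isSubmodular_shift_neg hp hI hr)] with k hk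
  exact sum_measure_update_le_of_shift_neg hI hne Nat.one_div_pos_of_nat hk (hmax _ hk)


/-! ### Raising a price -/

/-- The valuations for which the bundle `I` is better than all others by at least `t`. -/
def marginSet (p : PriceSchedule n) (I : Finset (Fin n)) (t : ℝ) : Set (Fin n → ℝ) :=
  {x | ∀ J, J ≠ I → p.bundleUtil J x ≤ p.bundleUtil I x - t}

theorem measurableSet_marginSet (p : PriceSchedule n) (I : Finset (Fin n)) (t : ℝ) :
    MeasurableSet (p.marginSet I t) := by
  have : p.marginSet I t =
      ⋂ J, ⋂ (_ : J ≠ I), {x | p.bundleUtil J x ≤ p.bundleUtil I x - t} := by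
    ext x; simp [marginSet]
  rw [this]
  exact (isClosed_iInter fun J => isClosed_iInter fun _ =>
    isClosed_le (by fun_prop) (by fun_prop)).measurableSet

theorem util_sub_util_shift_le (p : PriceSchedule n) {I : Finset (Fin n)} (hI : I.Nonempty) (t : ℝ)
    (x : Fin n → ℝ) :
    p.util x - (p.shift hI t).util x ≤ {x | p.util x = p.bundleUtil I x}.indicator 1 x * t := by
  by_cases h : p.util x = p.bundleUtil I x
  · rw [indicator_of_mem (by exact h), Pi.one_apply, one_mul, h]
    have := (p.shift hI t).bundleUtil_le_util I x
    rw [bundleUtil_shift_self] at this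
    linarith
  · rw [indicator_of_notMem (by exact h), zero_mul, sub_nonpos]
    obtain ⟨J, hJ⟩ := p.exists_util_eq x
    have hJI : J ≠ I := fun e => h (e ▸ hJ)
    rw [hJ, ← p.bundleUtil_shift_of_ne hI hJI t]
    exact bundleUtil_le_util _ J x

theorem indicator_marginSet_le (p : PriceSchedule n) {I : Finset (Fin n)} (hI : I.Nonempty) {t : ℝ}
    (ht : 0 ≤ t) (x : Fin n → ℝ) :
    (p.marginSet I t).indicator 1 x * t ≤ p.util x - (p.shift hI t).util x := by
  by_cases h : x ∈ p.marginSet I t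
  · rw [indicator_of_mem h, Pi.one_apply, one_mul]
    have h1 := p.bundleUtil_le_util I x
    have h2 : (p.shift hI t).util x ≤ p.bundleUtil I x - t := by
      refine (util_le_iff _ x _).2 fun J => ?_
      by_cases hJ : J = I
      · subst hJ
        rw [bundleUtil_shift_self]
      · rw [bundleUtil_shift_of_ne p hI hJ]
        exact h J hJ
    linarith
  · rw [indicator_of_notMem h, zero_mul, sub_nonneg]
    refine (util_le_iff _ x _).2 fun J => ?_
    have h1 := p.bundleUtil_le_util J x
    by_cases hJ : J = I
    · subst hJ
      rw [bundleUtil_shift_self]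
      linarith
    · rwa [bundleUtil_shift_of_ne p hI hJ]

theorem measurableSet_update_util_eq (p : PriceSchedule n) (I : Finset (Fin n)) (i : Fin n) :
    MeasurableSet {x | p.util (Function.update x i 1) = p.bundleUtil I (Function.update x i 1)} :=
  (isClosed_eq (by fun_prop) (by fun_prop)).measurableSet

/-- The price rise costs the buyer at least t where I leads by t, and at most t, only where I was
optimal. The first bound is used inside, the second on the faces, and t cancels. -/
theorem measure_marginSet_le {p : PriceSchedule n} {I : Finset (Fin n)} (hI : I.Nonempty) {t : ℝ}
    (ht : 0 < t) (hrev : (p.shift hI t).revenue ≤ p.revenue) :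
    (n + 1) * (cubeMeasure (Fin n)).real (p.marginSet I t) ≤
      ∑ i, (cubeMeasure (Fin n)).real
        {x | p.util (Function.update x i 1) = p.bundleUtil I (Function.update x i 1)} := by
  rw [revenue_le_iff] at hrev
  set q := p.shift hI t with hqdef
  have h1 : (cubeMeasure (Fin n)).real (p.marginSet I t) * t ≤
      -∫ x, (q.util x - p.util x) ∂cubeMeasure (Fin n) := by
    have hm := p.measurableSet_marginSet I t
    rw [← integral_neg, ← integral_indicator_one hm, ← integral_mul_const]
    refine integral_mono (integrable_indicator_one_mul hm continuous_const)
      (integrable_cubeMeasure_of_continuous (by fun_prop)) fun x => ?_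
    have := p.indicator_marginSet_le hI ht.le x
    simp only [neg_sub]
    exact this
  have h2 : ∀ i, -((cubeMeasure (Fin n)).real
        {x | p.util (Function.update x i 1) = p.bundleUtil I (Function.update x i 1)} * t) ≤
      ∫ x, (q.util (Function.update x i 1) - p.util (Function.update x i 1))
        ∂cubeMeasure (Fin n) := by
    intro i
    have hm := p.measurableSet_update_util_eq I i
    rw [neg_le, ← integral_neg, ← integral_indicator_one hm, ← integral_mul_const]
    refine integral_mono ((q.integrable_util_update i).sub (p.integrable_util_update i)).neg
      (integrable_indicator_one_mul hm continuous_const) fun x => ?_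
    have := p.util_sub_util_shift_le hI t (Function.update x i 1)
    simp only [neg_sub]
    exact this
  have h3 := Finset.sum_le_sum fun i (_ : i ∈ Finset.univ) => h2 i
  rw [Finset.sum_neg_distrib, ← Finset.sum_mul] at h3
  refine le_of_mul_le_mul_right ?_ ht
  have h4 := mul_le_mul_of_nonneg_left h1 (by positivity : (0:ℝ) ≤ n + 1)
  linarith

/-- Off ties, an optimal I leads its finitely many competitors by a positive margin, so the sets
exhaust the region up to a null set. -/
theorem tendsto_measureReal_marginSet (p : PriceSchedule n) (I : Finset (Fin n)) :
    Tendsto (fun k : ℕ => (cubeMeasure (Fin n)).real (p.marginSet I (1 / ((k : ℝ) + 1)))) atTop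
      (𝓝 (p.regionVol I)) := by
  have hU : p.regionVol I =
      (cubeMeasure (Fin n)).real (⋃ k : ℕ, p.marginSet I (1 / ((k : ℝ) + 1))) := by
    rw [regionVol_eq]
    refine measureReal_congr ?_
    filter_upwards [p.ae_bundleUtil_injective] with x hx
    refine propext (Iff.trans ?_ mem_iUnion.symm)
    constructor
    · intro h
      have h : p.util x = p.bundleUtil I x := h
      have h1 : ∀ J, ∀ᶠ k : ℕ in atTop,
          J ≠ I → p.bundleUtil J x ≤ p.bundleUtil I x - 1 / ((k : ℝ) + 1) := by
        intro J
        by_cases hJ : J = I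
        · exact Eventually.of_forall fun _ hne => absurd hJ hne
        have hlt : 0 < p.bundleUtil I x - p.bundleUtil J x :=
          sub_pos.2 (lt_of_le_of_ne (h ▸ p.bundleUtil_le_util J x) fun e => hJ (hx _ _ e))
        filter_upwards [tendsto_one_div_add_atTop_nhds_zero_nat.eventually (gt_mem_nhds hlt)]
          with k hk _
        linarith
      exact (eventually_all.2 h1).exists
    · rintro ⟨k, hk⟩
      refine le_antisymm ((p.util_le_iff x _).2 fun J => ?_) (p.bundleUtil_le_util I x)
      by_cases hJ : J = I
      · rw [hJ]
      · have := hk J hJ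
        have : 0 < 1 / ((k : ℝ) + 1) := Nat.one_div_pos_of_nat
        linarith
  rw [hU]
  refine (ENNReal.tendsto_toReal (measure_ne_top _ _)).comp (tendsto_measure_iUnion_atTop ?_)
  intro k l hkl x hx J hJ
  have := hx J hJ
  have := Nat.one_div_le_one_div (α := ℝ) hkl
  linarith

theorem mul_regionVol_le {p : PriceSchedule n} (hp : p.IsSubmodular)
    (hmax : ∀ q : PriceSchedule n, q.IsSubmodular → q.revenue ≤ p.revenue) {I : Finset (Fin n)}
    (hI : I.Nonempty) (hl : ¬ p.LeftTight I) :
    (n + 1) * p.regionVol I ≤ ∑ i, (cubeMeasure (Fin n)).real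
        {x | p.util (Function.update x i 1) = p.bundleUtil I (Function.update x i 1)} := by
  refine le_of_tendsto ((p.tendsto_measureReal_marginSet I).const_mul _) ?_
  filter_upwards [tendsto_one_div_add_one_nhdsGT.eventually
    (eventually_isSubmodular_shift hp hI hl)] with k hk
  exact measure_marginSet_le hI Nat.one_div_pos_of_nat (hmax _ hk)

/-! ### Selling an item as an add-on -/

/-- The price schedule in which the item `i` may be added to any bundle at the price `c`. -/
def addOffer (p : PriceSchedule n) (i : Fin n) (c : ℝ) : PriceSchedule n where
  price J := if i ∈ J then min (p.price J) (p.price (J.erase i) + c) else p.price J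
  price_empty := by rw [if_neg (Finset.notMem_empty i), p.price_empty]

theorem price_addOffer_of_notMem (p : PriceSchedule n) {i : Fin n} {J : Finset (Fin n)}
    (h : i ∉ J) (c : ℝ) : (p.addOffer i c).price J = p.price J := if_neg h

theorem price_addOffer_of_mem (p : PriceSchedule n) {i : Fin n} {J : Finset (Fin n)}
    (h : i ∈ J) (c : ℝ) :
    (p.addOffer i c).price J = min (p.price J) (p.price (J.erase i) + c) := if_pos h

/-- Each way of attaining the minima for A and B, with or without the offer, is matched by
candidates for the union and the intersection using the offer equally often. Submodularity of p
compares the two. -/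
theorem IsSubmodular.addOffer {p : PriceSchedule n} (hp : p.IsSubmodular) (i : Fin n) (c : ℝ) :
    (p.addOffer i c).IsSubmodular := by
  intro A B
  have h1 := hp A B
  have h2 := hp (A.erase i) B
  have h3 := hp A (B.erase i)
  have h4 := hp (A.erase i) (B.erase i)
  by_cases hA : i ∈ A <;> by_cases hB : i ∈ B
  · have e1 : (A ∪ B).erase i = A.erase i ∪ B.erase i := Finset.erase_union_distrib A B i
    have e2 : A.erase i ∩ B.erase i = (A ∩ B).erase i := by grind
    have e3 : A.erase i ∪ B = A ∪ B := by grind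
    have e4 : A ∪ B.erase i = A ∪ B := by grind
    have e5 : A.erase i ∩ B = (A ∩ B).erase i := by grind
    have e6 : A ∩ B.erase i = (A ∩ B).erase i := by grind
    rw [price_addOffer_of_mem p hA, price_addOffer_of_mem p hB,
      price_addOffer_of_mem p (Finset.mem_union_left B hA),
      price_addOffer_of_mem p (Finset.mem_inter.2 ⟨hA, hB⟩), e1]
    rw [e2] at h4
    rw [e3, e5] at h2
    rw [e4, e6] at h3
    grind
  · have e1 : (A ∪ B).erase i = A.erase i ∪ B := by grind
    have e2 : A.erase i ∩ B = A ∩ B := by grind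
    rw [price_addOffer_of_mem p hA, price_addOffer_of_notMem p hB,
      price_addOffer_of_mem p (Finset.mem_union_left B hA),
      price_addOffer_of_notMem p fun h => hB (Finset.mem_inter.1 h).2, e1]
    rw [e2] at h2
    grind
  · have e1 : (A ∪ B).erase i = A ∪ B.erase i := by grind
    have e2 : A ∩ B.erase i = A ∩ B := by grind
    rw [price_addOffer_of_notMem p hA, price_addOffer_of_mem p hB,
      price_addOffer_of_mem p (Finset.mem_union_right A hB),
      price_addOffer_of_notMem p fun h => hA (Finset.mem_inter.1 h).1, e1]
    rw [e2] at h3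
    grind
  · rw [price_addOffer_of_notMem p hA, price_addOffer_of_notMem p hB,
      price_addOffer_of_notMem p fun h => (Finset.mem_union.1 h).elim hA hB,
      price_addOffer_of_notMem p fun h => hA (Finset.mem_inter.1 h).1]
    exact h1

theorem price_addOffer_le (p : PriceSchedule n) (i : Fin n) (c : ℝ) (J : Finset (Fin n)) :
    (p.addOffer i c).price J ≤ p.price J := by
  by_cases h : i ∈ J
  · exact (price_addOffer_of_mem p h c).trans_le (min_le_left _ _)
  · exact (price_addOffer_of_notMem p h c).le

theorem util_le_util_addOffer (p : PriceSchedule n) (i : Fin n) (c : ℝ) (x : Fin n → ℝ) :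
    p.util x ≤ (p.addOffer i c).util x := by
  refine (util_le_iff _ x _).2 fun J => le_trans ?_ (bundleUtil_le_util _ J x)
  exact sub_le_sub_left (p.price_addOffer_le i c J) _

/-- A buyer who uses the offer can drop i again, forgoing only xᵢ - c. -/
theorem util_addOffer_sub_le (p : PriceSchedule n) (i : Fin n) (c : ℝ) (x : Fin n → ℝ) :
    (p.addOffer i c).util x - p.util x ≤ max 0 (x i - c) := by
  rw [sub_le_iff_le_add']
  refine (util_le_iff _ x _).2 fun J => ?_
  have hJ := p.bundleUtil_le_util J x
  have h0 := le_max_left 0 (x i - c)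
  have h1 := le_max_right 0 (x i - c)
  by_cases h : i ∈ J
  · have hJe := p.bundleUtil_le_util (J.erase i) x
    have hs := Finset.sum_erase_add J x h
    rw [bundleUtil] at *
    rw [price_addOffer_of_mem p h]
    rcases min_choice (p.price J) (p.price (J.erase i) + c) with e | e <;> rw [e] <;> linarith
  · rw [bundleUtil] at *
    rw [price_addOffer_of_notMem p h]
    linarith

theorem add_le_util_addOffer (p : PriceSchedule n) {i : Fin n} {I : Finset (Fin n)} (hi : i ∉ I)
    (c : ℝ) (x : Fin n → ℝ) : p.bundleUtil I x + (x i - c) ≤ (p.addOffer i c).util x := by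
  have h := (p.addOffer i c).bundleUtil_le_util (insert i I) x
  rw [bundleUtil, Finset.sum_insert hi, price_addOffer_of_mem p (Finset.mem_insert_self i I),
    Finset.erase_insert hi] at h
  have := min_le_right (p.price (insert i I)) (p.price I + c)
  rw [bundleUtil]
  linarith

/-- The integrand is at most s and is supported on a slab of thickness s. -/
theorem integral_max_eval_sub_le (i : Fin n) {s : ℝ} (hs : 0 < s) :
    ∫ x, max 0 (x i - (1 - s)) ∂cubeMeasure (Fin n) ≤ s * s := by
  have hm : MeasurableSet {x : Fin n → ℝ | 1 - s ≤ x i} :=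
    measurableSet_le (by fun_prop) (by fun_prop)
  have hle : (cubeMeasure (Fin n)).real {x : Fin n → ℝ | 1 - s ≤ x i} ≤ s := by
    have h := measurePreserving_eval (fun _ : Fin n => volume.restrict (Icc (0 : ℝ) 1)) i
    have h1 : (cubeMeasure (Fin n)).real {x : Fin n → ℝ | 1 - s ≤ x i} =
        (volume.restrict (Icc (0 : ℝ) 1)).real (Ici (1 - s)) :=
      congrArg ENNReal.toReal (h.measure_preimage measurableSet_Ici.nullMeasurableSet)
    rw [h1, measureReal_restrict_apply measurableSet_Ici]
    calc _ ≤ volume.real (Icc (1 - s) 1) :=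
          measureReal_mono (fun t ht => ⟨ht.1, ht.2.2⟩) (by simp)
      _ = s := by rw [Real.volume_real_Icc_of_le (by linarith)]; ring
  calc _ ≤ ∫ x, {x : Fin n → ℝ | 1 - s ≤ x i}.indicator 1 x * s ∂cubeMeasure (Fin n) := by
        refine integral_mono_ae (integrable_cubeMeasure_of_continuous (by fun_prop))
          (integrable_indicator_one_mul hm continuous_const) ?_
        filter_upwards [ae_mem_cube (Fin n)] with x hx
        by_cases h : 1 - s ≤ x i
        · rw [indicator_of_mem (by exact h), Pi.one_apply, one_mul]
          exact max_le hs.le (by linarith [(hx i).2])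
        · rw [indicator_of_notMem (by exact h), zero_mul]
          exact max_le le_rfl (by linarith)
    _ = (cubeMeasure (Fin n)).real {x : Fin n → ℝ | 1 - s ≤ x i} * s := by
        rw [integral_mul_const, integral_indicator_one hm]
    _ ≤ s * s := by gcongr

/-- With the add-on price 1 - s, utility rises by at least s wherever I is optimal on the face xᵢ =
1, while its integral over the cube rises by at most s². Optimality bounds the measure by (n+1)s for
every s > 0. -/
theorem measure_update_util_eq_eq_zero {p : PriceSchedule n} (hp : p.IsSubmodular)
    (hmax : ∀ q : PriceSchedule n, q.IsSubmodular → q.revenue ≤ p.revenue) {I : Finset (Fin n)}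
    {i : Fin n} (hi : i ∉ I) :
    (cubeMeasure (Fin n)).real
      {x | p.util (Function.update x i 1) = p.bundleUtil I (Function.update x i 1)} = 0 := by
  set F := {x | p.util (Function.update x i 1) = p.bundleUtil I (Function.update x i 1)} with hF
  have hm : MeasurableSet F := p.measurableSet_update_util_eq I i
  have key : ∀ s : ℝ, 0 < s → (cubeMeasure (Fin n)).real F ≤ (n + 1) * s := by
    intro s hs
    have hrev := hmax _ (hp.addOffer i (1 - s))
    rw [revenue_le_iff] at hrev
    set q := p.addOffer i (1 - s) with hqdef
    have h0 : ∀ x, 0 ≤ q.util x - p.util x :=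
      fun x => sub_nonneg.2 (p.util_le_util_addOffer i (1 - s) x)
    have h1 : ∫ x, (q.util x - p.util x) ∂cubeMeasure (Fin n) ≤ s * s :=
      (integral_mono (integrable_cubeMeasure_of_continuous (by fun_prop))
        (integrable_cubeMeasure_of_continuous (by fun_prop))
        fun x => p.util_addOffer_sub_le i (1 - s) x).trans (integral_max_eval_sub_le i hs)
    have h2 : (cubeMeasure (Fin n)).real F * s ≤
        ∫ x, (q.util (Function.update x i 1) - p.util (Function.update x i 1))
          ∂cubeMeasure (Fin n) := by
      rw [← integral_indicator_one hm, ← integral_mul_const]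
      refine integral_mono (integrable_indicator_one_mul hm continuous_const)
        ((q.integrable_util_update i).sub (p.integrable_util_update i)) fun x => ?_
      by_cases hx : x ∈ F
      · have h3 := p.add_le_util_addOffer hi (1 - s) (Function.update x i 1)
        rw [Function.update_self] at h3
        have h4 : p.util (Function.update x i 1) = p.bundleUtil I (Function.update x i 1) := hx
        simp only [indicator_of_mem hx, Pi.one_apply, one_mul]
        linarith
      · simp only [indicator_of_notMem hx, zero_mul]
        exact h0 _
    have h3 : ∫ x, (q.util (Function.update x i 1) - p.util (Function.update x i 1))
          ∂cubeMeasure (Fin n) ≤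
        ∑ i, ∫ x, (q.util (Function.update x i 1) - p.util (Function.update x i 1))
          ∂cubeMeasure (Fin n) :=
      Finset.single_le_sum (f := fun i => ∫ x, (q.util (Function.update x i 1) -
        p.util (Function.update x i 1)) ∂cubeMeasure (Fin n))
        (fun i _ => integral_nonneg fun x => h0 _) (Finset.mem_univ i)
    have h4 := mul_le_mul_of_nonneg_left h1 (by positivity : (0:ℝ) ≤ n + 1)
    refine le_of_mul_le_mul_right ?_ hs
    linarith
  refine le_antisymm (le_of_forall_pos_le_add fun ε hε => ?_) measureReal_nonneg
  have := key (ε / (n + 1)) (by positivity)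
  rwa [mul_div_cancel₀ _ (by positivity), ← zero_add ε] at this

/-! ### Product structure of the regions and volumes of their projections -/

theorem isCompact_region (p : PriceSchedule n) (I : Finset (Fin n)) : IsCompact (p.region I) := by
  have : p.region I = (univ.pi fun _ => Icc (0 : ℝ) 1) ∩ {x | p.util x = p.bundleUtil I x} := by
    ext x
    rw [mem_region_iff, mem_inter_iff, mem_univ_pi, mem_ofPred_eq]
  rw [this]
  exact (isCompact_univ_pi fun _ => isCompact_Icc).inter_right
    (isClosed_eq p.continuous_util (p.continuous_bundleUtil I))

theorem IsSubmodular.piecewise_mem_region {p : PriceSchedule n} (hp : p.IsSubmodular)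
    {I : Finset (Fin n)} {x y : Fin n → ℝ} (hx : ∀ i, x i ∈ Icc (0 : ℝ) 1)
    (hxI : x ∈ p.nearOptBelow I 0) (hy : y ∈ p.region I) : I.piecewise x y ∈ p.region I := by
  rw [mem_region_iff, hp.util_eq_iff] at hy ⊢
  refine ⟨fun i => ?_, (p.mem_nearOptBelow_congr fun j hj =>
    Finset.piecewise_eq_of_mem _ _ _ hj).2 hxI, ?_⟩
  · by_cases h : i ∈ I <;> simp only [Finset.piecewise, h, if_true, if_false]
    · exact hx i
    · exact hy.1 i
  · rw [gainAbove_piecewise]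
    exact hy.2.2

/-- One point of the region supplies coordinates outside I that complete every cube point satisfying
the condition below I. -/
theorem volume_real_projRegion {p : PriceSchedule n} (hp : p.IsSubmodular) {I : Finset (Fin n)}
    (hne : (p.region I).Nonempty) :
    volume.real (p.projRegion I) = (cubeMeasure (Fin n)).real (p.nearOptBelow I 0) := by
  obtain ⟨y, hy⟩ := hne
  have hcube : ∀ z ∈ p.projRegion I, ∀ i, z i ∈ Icc (0 : ℝ) 1 := by
    rintro _ ⟨x, hx, rfl⟩ i
    exact hx.1 i
  have hm : MeasurableSet (p.projRegion I) :=
    ((p.isCompact_region I).image (by fun_prop)).measurableSet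
  rw [volume_real_eq_cubeMeasure hcube, measureReal_def,
    ← (measurePreserving_restrict_cubeMeasure I).measure_preimage hm.nullMeasurableSet,
    ← measureReal_def]
  refine measureReal_congr ?_
  filter_upwards [ae_mem_cube (Fin n)] with x hx
  refine propext ⟨?_, fun h => ⟨I.piecewise x y, hp.piecewise_mem_region hx h hy, ?_⟩⟩
  · rintro ⟨z, hz, hzx⟩
    rw [mem_region_iff, hp.util_eq_iff] at hz
    exact (p.mem_nearOptBelow_congr fun j hj => congrFun hzx ⟨j, hj⟩).1 hz.2.1
  · funext j
    exact Finset.piecewise_eq_of_mem _ _ _ j.2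

/-- Raising xᵢ helps I at least as much as any subset. Hence projecting away i amounts to slicing at
xᵢ = 1. -/
theorem update_mem_nearOptBelow (p : PriceSchedule n) {I : Finset (Fin n)} {i : Fin n} (hi : i ∈ I)
    {s t : ℝ} {x : Fin n → ℝ} (hx : x ∈ p.nearOptBelow I s) (ht : x i ≤ t) :
    Function.update x i t ∈ p.nearOptBelow I s := by
  intro J hJ
  have := hx J hJ
  rw [bundleUtil_update_of_mem p hi]
  by_cases h : i ∈ J
  · rw [bundleUtil_update_of_mem p h]
    linarith
  · rw [bundleUtil_update_of_notMem p h]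
    linarith

theorem volume_real_projRegionErase {p : PriceSchedule n} (hp : p.IsSubmodular)
    {I : Finset (Fin n)} (hne : (p.region I).Nonempty) {i : Fin n} (hi : i ∈ I) :
    volume.real (p.projRegionErase I i) =
      (cubeMeasure (Fin n)).real {x | Function.update x i 1 ∈ p.nearOptBelow I 0} := by
  obtain ⟨y, hy⟩ := hne
  have hcube : ∀ z ∈ p.projRegionErase I i, ∀ j, z j ∈ Icc (0 : ℝ) 1 := by
    rintro _ ⟨_, ⟨x, hx, rfl⟩, rfl⟩ j
    exact hx.1 j
  have hc : Continuous (Finset.restrict₂ (π := fun _ => ℝ) (Finset.erase_subset i I)) :=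
    continuous_pi fun _ => continuous_apply _
  have hc' : Continuous (I.restrict (π := fun _ => ℝ)) := by fun_prop
  have hm : MeasurableSet (p.projRegionErase I i) :=
    (((p.isCompact_region I).image hc').image hc).measurableSet
  rw [volume_real_eq_cubeMeasure hcube, measureReal_def,
    ← (measurePreserving_restrict_cubeMeasure (I.erase i)).measure_preimage hm.nullMeasurableSet,
    ← measureReal_def]
  refine measureReal_congr ?_
  filter_upwards [ae_mem_cube (Fin n)] with x hx
  refine propext ⟨?_, fun h => ⟨_, ⟨I.piecewise (Function.update x i 1) y,
    hp.piecewise_mem_region (fun j => ?_) h hy, rfl⟩, ?_⟩⟩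
  · rintro ⟨_, ⟨z, hz, rfl⟩, hzx⟩
    have hz1 := (hz.1 i).2
    rw [mem_region_iff, hp.util_eq_iff] at hz
    refine (p.mem_nearOptBelow_congr fun j hj => ?_).1
      (p.update_mem_nearOptBelow hi hz.2.1 hz1)
    by_cases h : j = i
    · subst h; simp
    · rw [Function.update_of_ne h, Function.update_of_ne h]
      exact congrFun hzx ⟨j, Finset.mem_erase.2 ⟨h, hj⟩⟩
  · by_cases h : j = i
    · subst h; simp
    · rw [Function.update_of_ne h]
      exact hx j
  · funext j
    have hj := Finset.mem_erase.1 j.2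
    exact (Finset.piecewise_eq_of_mem _ _ _ hj.2).trans (Function.update_of_ne hj.1 _ _)

theorem regionVol_eq_mul {p : PriceSchedule n} (hp : p.IsSubmodular) (I : Finset (Fin n)) :
    p.regionVol I = (cubeMeasure (Fin n)).real (p.nearOptBelow I 0) *
      (cubeMeasure (Fin n)).real {x | p.gainAbove I x ≤ 0} := by
  rw [regionVol_eq, ← measureReal_inter_of_piecewise I
    (p.isClosed_nearOptBelow I 0).measurableSet
    (isClosed_le (p.continuous_gainAbove I) continuous_const).measurableSet
    (fun x y => p.mem_nearOptBelow_congr fun j hj => Finset.piecewise_eq_of_mem _ _ _ hj)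
    fun x y => by rw [mem_ofPred_eq, gainAbove_piecewise, mem_ofPred_eq]]
  congr 1
  ext x
  exact hp.util_eq_iff I x

theorem measure_update_util_eq_eq_mul {p : PriceSchedule n} (hp : p.IsSubmodular)
    {I : Finset (Fin n)} {i : Fin n} (hi : i ∈ I) :
    (cubeMeasure (Fin n)).real
        {x | p.util (Function.update x i 1) = p.bundleUtil I (Function.update x i 1)} =
      (cubeMeasure (Fin n)).real {x | Function.update x i 1 ∈ p.nearOptBelow I 0} *
      (cubeMeasure (Fin n)).real {x | p.gainAbove I x ≤ 0} := by
  rw [← measureReal_inter_of_piecewise I (p.measurableSet_update_nearOptBelow I i 0 1)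
    (isClosed_le (p.continuous_gainAbove I) continuous_const).measurableSet
    (fun x y => p.update_mem_nearOptBelow_piecewise i 0 1 x y)
    fun x y => by rw [mem_ofPred_eq, gainAbove_piecewise, mem_ofPred_eq]]
  congr 1
  ext x
  rw [mem_ofPred_eq, hp.util_eq_iff, gainAbove_update p hi]
  rfl

theorem deficiency_eq {p : PriceSchedule n} (hp : p.IsSubmodular) {I : Finset (Fin n)}
    (hne : (p.region I).Nonempty) :
    p.deficiency I = (cubeMeasure (Fin n)).real (p.nearOptBelow I 0) - 1 / ((n : ℝ) + 1) *
      ∑ i ∈ I, (cubeMeasure (Fin n)).real {x | Function.update x i 1 ∈ p.nearOptBelow I 0} := by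
  rw [deficiency, volume_real_projRegion hp hne,
    Finset.sum_congr rfl fun i hi => volume_real_projRegionErase hp hne hi]

/-! ### The sign of the deficiency -/

theorem deficiency_nonneg {p : PriceSchedule n} (hp : p.IsSubmodular)
    (hmax : ∀ q : PriceSchedule n, q.IsSubmodular → q.revenue ≤ p.revenue) {I : Finset (Fin n)}
    (hr : ¬ p.RightTight I) : 0 ≤ p.deficiency I := by
  rcases I.eq_empty_or_nonempty with rfl | hI
  · rw [deficiency, Finset.sum_empty, mul_zero, sub_zero]
    exact measureReal_nonneg
  rcases (p.region I).eq_empty_or_nonempty with he | hne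
  · simp [deficiency, projRegion, projRegionErase, he]
  rw [deficiency_eq hp hne, sub_nonneg, one_div, inv_mul_le_iff₀ (by positivity)]
  exact sum_measure_update_le hp hmax hI hne hr

theorem deficiency_nonpos {p : PriceSchedule n} (hp : p.IsSubmodular)
    (hmax : ∀ q : PriceSchedule n, q.IsSubmodular → q.revenue ≤ p.revenue) {I : Finset (Fin n)}
    (hI : I.Nonempty) (hl : ¬ p.LeftTight I) (hpos : 0 < p.regionVol I) :
    p.deficiency I ≤ 0 := by
  have hne : (p.region I).Nonempty := by
    by_contra h
    rw [not_nonempty_iff_eq_empty] at h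
    simp [regionVol, h] at hpos
  have h := mul_regionVol_le hp hmax hI hl
  rw [← Finset.sum_subset (Finset.subset_univ I)
      fun i _ hi => measure_update_util_eq_eq_zero hp hmax hi,
    Finset.sum_congr rfl fun i hi => measure_update_util_eq_eq_mul hp hi, ← Finset.sum_mul,
    regionVol_eq_mul hp, ← mul_assoc] at h
  rw [regionVol_eq_mul hp] at hpos
  rw [deficiency_eq hp hne, sub_nonpos, one_div, le_inv_mul_iff₀ (by positivity)]
  -- Positive volume of the region makes the common factor from the coordinates outside I positive,
  -- so it cancels.
  exact le_of_mul_le_mul_right h (pos_of_mul_pos_right hpos measureReal_nonneg)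

end PriceSchedule
end DetAuction

theorem mainTheorem10 (n : ℕ) (p : DetAuction.PriceSchedule n)
    (hp : p.IsSubmodular)
    (hmax : ∀ q : DetAuction.PriceSchedule n, q.IsSubmodular → q.revenue ≤ p.revenue)
    (I : Finset (Fin n)) :
    (I.Nonempty → ¬ p.Tight I → 0 < p.regionVol I → p.deficiency I = 0) ∧
    (¬ p.Tight I → p.regionVol I = 0 → 0 ≤ p.deficiency I) ∧
    (p.LeftTight I → ¬ p.RightTight I → 0 ≤ p.deficiency I) ∧
    (p.RightTight I → ¬ p.LeftTight I → 0 < p.regionVol I → p.deficiency I ≤ 0) := by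
  refine ⟨fun hI ht hv => ?_, fun ht _ => ?_, fun _ hr => ?_, fun hr hl hv => ?_⟩
  · exact le_antisymm (DetAuction.PriceSchedule.deficiency_nonpos hp hmax hI
      (fun h => ht (Or.inl h)) hv)
      (DetAuction.PriceSchedule.deficiency_nonneg hp hmax fun h => ht (Or.inr h))
  · exact DetAuction.PriceSchedule.deficiency_nonneg hp hmax fun h => ht (Or.inr h)
  · exact DetAuction.PriceSchedule.deficiency_nonneg hp hmax hr
  · refine DetAuction.PriceSchedule.deficiency_nonpos hp hmax ?_ hl hv
    -- A right tight bundle is nonempty, because the empty bundle is comparable with every other.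
    obtain ⟨A, B, ⟨hAB, hBA, -⟩, rfl | rfl⟩ := hr
    · exact Finset.nonempty_iff_ne_empty.2 fun h => hAB (h ▸ Finset.empty_subset B)
    · exact Finset.nonempty_iff_ne_empty.2 fun h => hBA (h ▸ Finset.empty_subset A)
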